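/- Let $d\ge 0$ (the planar case is $d=2$), let $(\Omega,\mathcal A,\mathbb P)$ be a probability space and $(\theta_x)_{x\in\mathbb R^d}$ a measurable flow on $\Omega$ that preserves $\mathbb P$. Let $\Phi=\sum_n\delta_{T_n}$ be a simple, locally finite point process on $\mathbb R^d$ with finite intensity $\lambda=\mathbb E[\Phi([0,1)^d)]$ that is compatible with the flow, i.e. $\Phi(\theta_x\omega,B)=\Phi(\omega,B+x)$ for all $\omega$, $x$ and Borel $B$; its atoms are the access points (APs). Let $\mathbb P^o$ be the Palm probability of $\Phi$, $\mathbb P^o(A)=\lambda^{-1}\,\mathbb E\big[\sum_{T_n\in[0,1)^d}\mathbf 1(\theta_{T_n}\omega\in A)\big]$, under which $T_0=0$ is an atom. Each AP carries a tier $J(T_n)\in\{1,\dots,K\}$ and a field $S_n(y)\in[0,\infty]$, $y\in\mathbb R^d$, which are measurable marks: $J(T_0)\circ\theta_{T_n}=J(T_n)$ and $S_0(y)\circ\theta_{T_n}=S_n(y+T_n)$. Let $p_k=\mathbb P^o(J(T_0)=k)$, and let $\Phi_k$ be the process of the APs of tier $k$. A user at $y$ associates with the AP $\kappa(y)=\arg\sup_n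 S_n(y)$ (defined where there is a unique maximizer), and $\mathcal C(T_n)=\{y:\kappa(y)=T_n\}$ is the association cell of $T_n$, with volume (area) $|\mathcal C(T_n)|$. Then, for each tier $i$, the probability that the origin is contained in the association cell of an atom of $\Phi_i$ is $$\mathcal A_i:=\mathbb P\big(J(\kappa(0))=i\big)=\lambda\,p_i\,\mathbb E^{o,i}\big[|\mathcal C(T_0)|\big],$$ where $\mathbb E^{o,i}$ is the expectation under the Palm probability $\mathbb P^{o,i}$ of $\Phi_i$. Here $\mathbb P^{o,i}=\mathbb P^o(\,\cdot\mid J(T_0)=i)$, and $\lambda p_i$ is the intensity of $\Phi_i$. (If $p_i=0$ or $\lambda=0$, Palm and conditional measures that are not defined are read as the zero measure, and both sides are $0$.) -/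

import Mathlib

open MeasureTheory ProbabilityTheory
open scoped ENNReal

namespace HetNet

/-- The Euclidean space `ℝ^d` in which access points and users live. -/
abbrev Space (d : ℕ) : Type := EuclideanSpace ℝ (Fin d)

/-- A measurable flow `(θ_x)` on `Ω`, indexed by `x ∈ ℝ^d`. -/
structure IsMeasurableFlow {d : ℕ} {Ω : Type*} [MeasurableSpace Ω]
    (θ : Space d → Ω → Ω) : Prop where
  zero : ∀ ω, θ 0 ω = ω
  add : ∀ x y ω, θ (x + y) ω = θ x (θ y ω)
  measurable : Measurable fun p : Space d × Ω => θ p.1 p.2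

/-- The probability `P` is stationary: it is preserved by every shift of the flow. -/
def IsStationary {d : ℕ} {Ω : Type*} [MeasurableSpace Ω] (P : Measure Ω)
    (θ : Space d → Ω → Ω) : Prop :=
  ∀ x, MeasurePreserving (θ x) P P

/-- The counting measure `B ↦ Φ(ω, B)`, the number of atoms of `Φ ω` in `B`. -/
noncomputable def counting {d : ℕ} {Ω : Type*} (Φ : Ω → Set (Space d)) (ω : Ω) :
    Measure (Space d) :=
  Measure.count.restrict (Φ ω)

/-- A (simple) point process, given by its random set of atoms: in every bounded region there are
finitely many atoms, and the number of atoms in every Borel set is a random variable. -/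
structure IsPointProcess {d : ℕ} {Ω : Type*} [MeasurableSpace Ω]
    (Φ : Ω → Set (Space d)) : Prop where
  locallyFinite : ∀ ω r, (Φ ω ∩ Metric.closedBall 0 r).Finite
  measurable_counting : ∀ B, MeasurableSet B → Measurable fun ω => counting Φ ω B

/-- Compatibility with the flow, `Φ(θ_x ω, B) = Φ(ω, B + x)`, in terms of atoms. -/
def IsCompatible {d : ℕ} {Ω : Type*} (θ : Space d → Ω → Ω) (Φ : Ω → Set (Space d)) : Prop :=
  ∀ x ω z, z ∈ Φ (θ x ω) ↔ z + x ∈ Φ ω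

/-- The unit cube `[0, 1)^d`. -/
def unitCube (d : ℕ) : Set (Space d) := {x | ∀ j, 0 ≤ x j ∧ x j < 1}

/-- The intensity of a stationary point process: the mean number of atoms in the unit cube. -/
noncomputable def intensity {d : ℕ} {Ω : Type*} [MeasurableSpace Ω] (P : Measure Ω)
    (Φ : Ω → Set (Space d)) : ℝ≥0∞ :=
  ∫⁻ ω, counting Φ ω (unitCube d) ∂P

/-- The Palm probability `P^o` of `Φ`:
`P^o(A) = λ⁻¹ E[ ∑_{x ∈ Φ ∩ [0,1)^d} 1(θ_x ω ∈ A) ]` (see `palm_apply`). -/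
noncomputable def palm {d : ℕ} {Ω : Type*} [MeasurableSpace Ω] (P : Measure Ω)
    (θ : Space d → Ω → Ω) (Φ : Ω → Set (Space d)) : Measure Ω :=
  (intensity P Φ)⁻¹ •
    P.bind fun ω => ((counting Φ ω).restrict (unitCube d)).map fun x => θ x ω

/-- A family of tier marks: `J ω x ∈ {1, …, K}` is the tier of the atom `x` of `Φ ω`, and
`J(T_0) ∘ θ_{T_n} = J(T_n)`. Only the values at atoms of `Φ ω` are meaningful. -/
structure IsTierMark {d K : ℕ} {Ω : Type*} [MeasurableSpace Ω] (θ : Space d → Ω → Ω)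
    (Φ : Ω → Set (Space d)) (J : Ω → Space d → Fin K) : Prop where
  measurable : Measurable fun p : Ω × Space d => J p.1 p.2
  shift : ∀ ω, ∀ x ∈ Φ ω, J (θ x ω) 0 = J ω x

/-- The point process of the atoms of tier `i`. -/
def tier {d K : ℕ} {Ω : Type*} (Φ : Ω → Set (Space d)) (J : Ω → Space d → Fin K) (i : Fin K) :
    Ω → Set (Space d) :=
  fun ω => {x | x ∈ Φ ω ∧ J ω x = i}

/-- A family of mark fields: `S ω x y ∈ [0, ∞]` is the value at the location `y` of the field
attached to the atom `x` of `Φ ω`, and `S_0(y) ∘ θ_{T_n} = S_n(y + T_n)`. -/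
structure IsMarkField {d : ℕ} {Ω : Type*} [MeasurableSpace Ω] (θ : Space d → Ω → Ω)
    (Φ : Ω → Set (Space d)) (S : Ω → Space d → Space d → ℝ≥0∞) : Prop where
  measurable : Measurable fun p : Ω × Space d × Space d => S p.1 p.2.1 p.2.2
  shift : ∀ ω, ∀ x ∈ Φ ω, ∀ y, S (θ x ω) 0 y = S ω x (y + x)

/-- The atom `x` of `Φ ω` is the unique maximizer of the field values at the location `y`. -/
def IsArgSup {d : ℕ} {Ω : Type*} (Φ : Ω → Set (Space d)) (S : Ω → Space d → Space d → ℝ≥0∞)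
    (ω : Ω) (y x : Space d) : Prop :=
  x ∈ Φ ω ∧ ∀ x' ∈ Φ ω, x' ≠ x → S ω x' y < S ω x y

open Classical in
/-- The association `κ(y) = arg sup_n S_n(y)`; the value is `none` where the arg sup is not
well defined (no maximizer, or several). -/
noncomputable def assoc {d : ℕ} {Ω : Type*} (Φ : Ω → Set (Space d))
    (S : Ω → Space d → Space d → ℝ≥0∞) (ω : Ω) (y : Space d) : Option (Space d) :=
  if h : ∃ x, IsArgSup Φ S ω y x then some h.choose else none

/-- The association cell `C(x) = {y : κ(y) = x}`. -/
def cell {d : ℕ} {Ω : Type*} (Φ : Ω → Set (Space d)) (S : Ω → Space d → Space d → ℝ≥0∞)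
    (ω : Ω) (x : Space d) : Set (Space d) :=
  {y | assoc Φ S ω y = some x}

theorem assoc_eq_some_iff {d : ℕ} {Ω : Type*} (Φ : Ω → Set (Space d))
    (S : Ω → Space d → Space d → ℝ≥0∞) (ω : Ω) (y x : Space d) :
    assoc Φ S ω y = some x ↔ IsArgSup Φ S ω y x := by
  have huniq : ∀ a b, IsArgSup Φ S ω y a → IsArgSup Φ S ω y b → a = b := by
    intro a b ha hb
    by_contra hne
    exact lt_asymm (ha.2 b hb.1 (Ne.symm hne)) (hb.2 a ha.1 hne)
  unfold assoc
  constructor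
  · intro h
    split_ifs at h with hx
    have h2 := hx.choose_spec
    rwa [Option.some.inj h] at h2
  · intro h
    have hx : ∃ x, IsArgSup Φ S ω y x := ⟨x, h⟩
    rw [dif_pos hx, huniq _ _ hx.choose_spec h]

theorem measurableSet_unitCube (d : ℕ) : MeasurableSet (unitCube d) := by
  have h : unitCube d = ⋂ j, {x : Space d | 0 ≤ x j ∧ x j < 1} := by
    ext x; simp [unitCube]
  rw [h]
  refine MeasurableSet.iInter fun j => ?_
  have hj : Measurable fun x : Space d => x j := by fun_prop
  exact (measurableSet_le measurable_const hj).inter (measurableSet_lt hj measurable_const)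

/-- The defining formula of the Palm probability. -/
theorem palm_apply {d : ℕ} {Ω : Type*} [MeasurableSpace Ω] (P : Measure Ω)
    (θ : Space d → Ω → Ω) (hθ : IsMeasurableFlow θ) (Φ : Ω → Set (Space d))
    (hΦ : IsPointProcess Φ) (A : Set Ω) (hA : MeasurableSet A) :
    palm P θ Φ A =
      (intensity P Φ)⁻¹ * ∫⁻ ω, counting Φ ω (unitCube d ∩ {x | θ x ω ∈ A}) ∂P := by
  have hθ1 : ∀ ω, Measurable fun x => θ x ω := fun ω =>
    hθ.measurable.comp (measurable_id.prodMk measurable_const)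
  have hQ := measurableSet_unitCube d
  have hfin : ∀ ω, counting Φ ω (unitCube d) < ∞ := by
    intro ω
    have hsub : unitCube d ⊆ Metric.closedBall 0 (Real.sqrt d) := by
      intro x hx
      rw [mem_closedBall_zero_iff, EuclideanSpace.norm_eq]
      refine Real.sqrt_le_sqrt ?_
      calc ∑ i, ‖x i‖ ^ 2 ≤ ∑ _i : Fin d, (1 : ℝ) := by
            refine Finset.sum_le_sum fun i _ => ?_
            have h1 := hx i
            rw [Real.norm_eq_abs, sq_abs]
            nlinarith [h1.1, h1.2]
        _ = d := by simp
    rw [counting, Measure.restrict_apply hQ]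
    refine Measure.count_apply_lt_top.2 ((hΦ.locallyFinite ω (Real.sqrt d)).subset ?_)
    exact fun x hx => ⟨hx.2, hsub hx.1⟩
  have : ∀ ω, IsFiniteMeasure (((counting Φ ω).restrict (unitCube d)).map fun x => (ω, x)) := by
    intro ω
    have : IsFiniteMeasure ((counting Φ ω).restrict (unitCube d)) := ⟨by simpa using hfin ω⟩
    infer_instance
  have hpair : Measurable fun ω =>
      ((counting Φ ω).restrict (unitCube d)).map fun x => (ω, x) := by
    have hbasic : ∀ (s : Set Ω) (t : Set (Space d)), MeasurableSet s → MeasurableSet t →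
        Measurable fun ω =>
          (((counting Φ ω).restrict (unitCube d)).map fun x => (ω, x)) (s ×ˢ t) := by
      intro s t hs ht
      have heq : (fun ω =>
          (((counting Φ ω).restrict (unitCube d)).map fun x => (ω, x)) (s ×ˢ t)) =
          s.indicator fun ω => counting Φ ω (t ∩ unitCube d) := by
        funext ω
        rw [Measure.map_apply measurable_prodMk_left (hs.prod ht)]
        by_cases hω : ω ∈ s
        · have h1 : (fun x : Space d => (ω, x)) ⁻¹' (s ×ˢ t) = t := by ext x; simp [hω]
          rw [h1, Set.indicator_of_mem hω, Measure.restrict_apply ht]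
        · have h1 : (fun x : Space d => (ω, x)) ⁻¹' (s ×ˢ t) = ∅ := by ext x; simp [hω]
          rw [h1, Set.indicator_of_notMem hω, measure_empty]
      rw [heq]
      exact (hΦ.measurable_counting _ (ht.inter hQ)).indicator hs
    refine Measurable.measure_of_isPiSystem generateFrom_prod.symm isPiSystem_prod ?_ ?_
    · rintro _ ⟨s, hs, t, ht, rfl⟩
      exact hbasic s t hs ht
    · rw [← Set.univ_prod_univ]
      exact hbasic _ _ MeasurableSet.univ MeasurableSet.univ
  have hm : Measurable fun ω =>
      ((counting Φ ω).restrict (unitCube d)).map fun x => θ x ω := by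
    have hsw : Measurable fun p : Ω × Space d => θ p.2 p.1 := hθ.measurable.comp measurable_swap
    have h2 := (Measure.measurable_map _ hsw).comp hpair
    convert h2 using 2 with ω
    simp only [Function.comp]
    rw [Measure.map_map hsw measurable_prodMk_left]
    rfl
  rw [palm, Measure.smul_apply, smul_eq_mul, Measure.bind_apply hA hm.aemeasurable]
  congr 1
  refine lintegral_congr fun ω => ?_
  rw [Measure.map_apply (hθ1 ω) hA, Measure.restrict_apply (hθ1 ω hA), Set.inter_comm]
  rfl

end HetNet

namespace HetNet

variable {d K : ℕ} {Ω : Type*}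

/-! The formula is a mass transport identity for the tier-`i` process `Ψ`. Each atom of `Ψ` spreads
unit-density mass over its cell. The mass sent by the atoms in the unit cube has mean `λ_i
E^{o,i}|C(T_0)|`, by the Campbell form of the Palm measure (`intensity_mul_lintegral_palm`) and
shift covariance of cells. Tonelli rewrites it as an integral over receiving sites `y`; stationarity
moves each `y` to the origin, and the translates of the cube then integrate to one
(`IsMarkField.lintegral_volume_cell`). What remains is the mean number of atoms of `Ψ` serving the
origin. By uniqueness of the arg sup this number is the indicator of the event.

Thinning by tier gives `λ_i = λ p_i` and the conditional form of the Palm measure. -/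

theorem counting_apply (Φ : Ω → Set (Space d)) (ω : Ω) {B : Set (Space d)}
    (hB : MeasurableSet B) : counting Φ ω B = Measure.count (B ∩ Φ ω) :=
  Measure.restrict_apply hB

theorem counting_eq_zero_iff (Φ : Ω → Set (Space d)) (ω : Ω) {B : Set (Space d)}
    (hB : MeasurableSet B) : counting Φ ω B = 0 ↔ ∀ x ∈ B, x ∉ Φ ω := by
  rw [counting_apply Φ ω hB, Measure.count_eq_zero_iff, Set.eq_empty_iff_forall_notMem]
  exact ⟨fun h x hx hx' => h x ⟨hx, hx'⟩, fun h x hx => h x hx.1 hx.2⟩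

theorem IsCompatible.counting_shift {θ : Space d → Ω → Ω} {Φ : Ω → Set (Space d)}
    (hθΦ : IsCompatible θ Φ) (y : Space d) (ω : Ω) {B : Set (Space d)} (hB : MeasurableSet B) :
    counting Φ (θ y ω) B = counting Φ ω ((fun z => z - y) ⁻¹' B) := by
  have hm : Measurable fun z : Space d => z - y := measurable_id.sub_const y
  rw [counting_apply _ _ hB, counting_apply _ _ (hm hB)]
  have : (fun z => z - y) ⁻¹' B ∩ Φ ω = (fun z => z + y) '' (B ∩ Φ (θ y ω)) := by
    ext z
    constructor
    · rintro ⟨h1, h2⟩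
      exact ⟨z - y, ⟨h1, (hθΦ y ω _).2 (by simpa using h2)⟩, by simp⟩
    · rintro ⟨w, ⟨h1, h2⟩, rfl⟩
      exact ⟨by simpa using h1, (hθΦ y ω w).1 h2⟩
  rw [this, Measure.count_injective_image (add_left_injective y)]

theorem mem_cell_iff {Φ : Ω → Set (Space d)}
    {S : Ω → Space d → Space d → ℝ≥0∞} {ω : Ω} {x y : Space d} :
    y ∈ cell Φ S ω x ↔ IsArgSup Φ S ω y x :=
  assoc_eq_some_iff Φ S ω y x

theorem IsArgSup.unique {Φ : Ω → Set (Space d)}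
    {S : Ω → Space d → Space d → ℝ≥0∞} {ω : Ω} {y a b : Space d} (ha : IsArgSup Φ S ω y a)
    (hb : IsArgSup Φ S ω y b) : a = b :=
  Option.some.inj (((assoc_eq_some_iff Φ S ω y a).2 ha).symm.trans
    ((assoc_eq_some_iff Φ S ω y b).2 hb))

theorem volume_unitCube (d : ℕ) : volume (unitCube d) = 1 := by
  have h : unitCube d = (WithLp.ofLp : Space d → Fin d → ℝ) ⁻¹'
      Set.univ.pi fun _ => Set.Ico (0 : ℝ) 1 := by
    ext x; simp [unitCube]
  rw [h, (PiLp.volume_preserving_ofLp (Fin d)).measure_preimage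
    (MeasurableSet.univ_pi fun _ => measurableSet_Ico).nullMeasurableSet, volume_pi_pi]
  simp

variable [MeasurableSpace Ω]

theorem IsMeasurableFlow.measurable_left {θ : Space d → Ω → Ω} (hθ : IsMeasurableFlow θ)
    (x : Space d) : Measurable (θ x) :=
  hθ.measurable.comp (measurable_const.prodMk measurable_id)

theorem IsMeasurableFlow.measurable_right {θ : Space d → Ω → Ω} (hθ : IsMeasurableFlow θ)
    (ω : Ω) : Measurable fun x => θ x ω :=
  hθ.measurable.comp (measurable_id.prodMk measurable_const)

/-! ### Measurability of point processes -/

namespace IsPointProcess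

variable {Φ : Ω → Set (Space d)}

theorem isLocallyFiniteMeasure (hΦ : IsPointProcess Φ) (ω : Ω) :
    IsLocallyFiniteMeasure (counting Φ ω) := by
  refine ⟨fun x => ⟨Metric.closedBall 0 (‖x‖ + 1), ?_, ?_⟩⟩
  · refine Filter.mem_of_superset (Metric.ball_mem_nhds x one_pos) fun y hy => ?_
    rw [mem_closedBall_zero_iff]
    rw [mem_ball_iff_norm] at hy
    have := norm_le_norm_add_norm_sub' y x
    linarith
  · rw [counting_apply _ _ Metric.isClosed_closedBall.measurableSet, Set.inter_comm]
    exact Measure.count_apply_lt_top.2 (hΦ.locallyFinite ω _)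

theorem comp (hΦ : IsPointProcess Φ) {Ω' : Type*} [MeasurableSpace Ω'] {f : Ω' → Ω}
    (hf : Measurable f) : IsPointProcess fun a => Φ (f a) where
  locallyFinite a r := hΦ.locallyFinite (f a) r
  measurable_counting B hB := (hΦ.measurable_counting B hB).comp hf

/-- The number of atoms in a jointly measurable random set is a random variable. -/
theorem measurable_counting_section (hΦ : IsPointProcess Φ) {t : Set (Ω × Space d)}
    (ht : MeasurableSet t) : Measurable fun ω => counting Φ ω (Prod.mk ω ⁻¹' t) := by
  have hmono : Monotone fun n : ℕ => Metric.closedBall (0 : Space d) n :=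
    fun m n h => Metric.closedBall_subset_closedBall (by exact_mod_cast h)
  -- Section measurability is available for finite kernels; exhausting by balls reduces to that case
  -- by local finiteness.
  have hsup : ∀ ω, counting Φ ω (Prod.mk ω ⁻¹' t) =
      ⨆ n : ℕ, (counting Φ ω).restrict (Metric.closedBall 0 n) (Prod.mk ω ⁻¹' t) := by
    intro ω
    have hs : MeasurableSet (Prod.mk ω ⁻¹' t) := measurable_prodMk_left ht
    simp_rw [Measure.restrict_apply hs]
    rw [← Monotone.measure_iUnion fun m n h => Set.inter_subset_inter_right _ (hmono h),
      ← Set.inter_iUnion, Metric.iUnion_closedBall_nat, Set.inter_univ]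
  simp_rw [hsup]
  refine Measurable.iSup fun n => ?_
  let κ : Kernel Ω (Space d) :=
    ⟨fun ω => (counting Φ ω).restrict (Metric.closedBall 0 n), by
      refine Measure.measurable_of_measurable_coe _ fun s hs => ?_
      simp_rw [Measure.restrict_apply hs]
      exact hΦ.measurable_counting _ (hs.inter Metric.isClosed_closedBall.measurableSet)⟩
  refine Kernel.measurable_kernel_prodMk_left_of_finite (κ := κ) ht fun ω => ⟨?_⟩
  change (counting Φ ω).restrict (Metric.closedBall 0 n) Set.univ < ∞
  rw [Measure.restrict_apply_univ, counting_apply _ _ Metric.isClosed_closedBall.measurableSet,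
    Set.inter_comm]
  exact Measure.count_apply_lt_top.2 (hΦ.locallyFinite ω _)

theorem measurable_counting_setOf (hΦ : IsPointProcess Φ) {p : Ω → Space d → Prop}
    (hp : MeasurableSet {q : Ω × Space d | p q.1 q.2}) :
    Measurable fun ω => counting Φ ω {x | p ω x} :=
  hΦ.measurable_counting_section hp

/-- The set of pairs `(ω, x)` such that `x` is an atom of `Φ ω` is measurable. -/
theorem measurableSet_graph {θ : Space d → Ω → Ω} (hθ : IsMeasurableFlow θ)
    (hΦ : IsPointProcess Φ) (hθΦ : IsCompatible θ Φ) :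
    MeasurableSet {q : Ω × Space d | q.2 ∈ Φ q.1} := by
  have h0 : MeasurableSet {ω | (0 : Space d) ∈ Φ ω} := by
    have : {ω | (0 : Space d) ∈ Φ ω} = {ω | counting Φ ω {0} = 0}ᶜ := by
      ext ω
      simp [counting_eq_zero_iff Φ ω (measurableSet_singleton (0 : Space d))]
    rw [this]
    exact (hΦ.measurable_counting _ (measurableSet_singleton 0) (measurableSet_singleton 0)).compl
  -- By compatibility, `x` is an atom for `ω` iff `0` is an atom for `θ x ω`, so one event at the
  -- origin suffices.
  have : {q : Ω × Space d | q.2 ∈ Φ q.1} =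
      (fun q : Ω × Space d => θ q.2 q.1) ⁻¹' {ω | (0 : Space d) ∈ Φ ω} := by
    ext q
    simp [hθΦ q.2 q.1 0]
  rw [this]
  exact (hθ.measurable.comp measurable_swap) h0

end IsPointProcess

/-! ### Campbell formula for the Palm measure -/

section Palm

variable {θ : Space d → Ω → Ω} {Φ : Ω → Set (Space d)}

theorem measurable_map_restrict_counting (hθ : IsMeasurableFlow θ) (hΦ : IsPointProcess Φ) :
    Measurable fun ω => ((counting Φ ω).restrict (unitCube d)).map fun x => θ x ω := by
  refine Measure.measurable_of_measurable_coe _ fun A hA => ?_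
  have h : ∀ ω, (((counting Φ ω).restrict (unitCube d)).map fun x => θ x ω) A =
      counting Φ ω {x | θ x ω ∈ A ∧ x ∈ unitCube d} := by
    intro ω
    rw [Measure.map_apply (hθ.measurable_right ω) hA,
      Measure.restrict_apply (hθ.measurable_right ω hA)]
    rfl
  simp_rw [h]
  exact hΦ.measurable_counting_setOf (((hθ.measurable.comp measurable_swap) hA).inter
    (measurable_snd (measurableSet_unitCube d)))

/-- The unnormalised Palm measure is the intensity times the Palm probability, also when the
intensity vanishes. -/
theorem intensity_smul_palm {P : Measure Ω} (hθ : IsMeasurableFlow θ) (hΦ : IsPointProcess Φ)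
    (hfin : intensity P Φ ≠ ∞) :
    intensity P Φ • palm P θ Φ =
      P.bind fun ω => ((counting Φ ω).restrict (unitCube d)).map fun x => θ x ω := by
  -- Here `0⁻¹ = ∞` does not cancel, but the total mass of the unnormalised measure is the intensity
  -- itself, so both sides vanish.
  by_cases h0 : intensity P Φ = 0
  · rw [h0, zero_smul, eq_comm, ← Measure.measure_univ_eq_zero,
      Measure.bind_apply .univ (measurable_map_restrict_counting hθ hΦ).aemeasurable, ← h0]
    refine lintegral_congr fun ω => ?_
    rw [Measure.map_apply (hθ.measurable_right ω) .univ, Set.preimage_univ,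
      Measure.restrict_apply_univ]
  · rw [palm, smul_smul, ENNReal.mul_inv_cancel h0 hfin, one_smul]

theorem intensity_mul_palm_apply {P : Measure Ω} (hθ : IsMeasurableFlow θ)
    (hΦ : IsPointProcess Φ) (hfin : intensity P Φ ≠ ∞) {A : Set Ω} (hA : MeasurableSet A) :
    intensity P Φ * palm P θ Φ A = ∫⁻ ω, counting Φ ω ({x | θ x ω ∈ A} ∩ unitCube d) ∂P := by
  rw [← smul_eq_mul, ← Measure.smul_apply, intensity_smul_palm hθ hΦ hfin,
    Measure.bind_apply hA (measurable_map_restrict_counting hθ hΦ).aemeasurable]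
  refine lintegral_congr fun ω => ?_
  rw [Measure.map_apply (hθ.measurable_right ω) hA,
    Measure.restrict_apply (hθ.measurable_right ω hA)]
  rfl

theorem intensity_mul_lintegral_palm {P : Measure Ω} (hθ : IsMeasurableFlow θ)
    (hΦ : IsPointProcess Φ) (hfin : intensity P Φ ≠ ∞) {f : Ω → ℝ≥0∞} (hf : Measurable f) :
    intensity P Φ * ∫⁻ ω, f ω ∂(palm P θ Φ) =
      ∫⁻ ω, ∫⁻ x in unitCube d, f (θ x ω) ∂(counting Φ ω) ∂P := by
  rw [← smul_eq_mul, ← lintegral_smul_measure, intensity_smul_palm hθ hΦ hfin,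
    Measure.lintegral_bind (measurable_map_restrict_counting hθ hΦ).aemeasurable hf.aemeasurable]
  exact lintegral_congr fun ω => lintegral_map hf (hθ.measurable_right ω)

end Palm

/-! ### Thinning by tier -/

section Tier

variable {θ : Space d → Ω → Ω} {Φ : Ω → Set (Space d)} {J : Ω → Space d → Fin K}

theorem IsTierMark.measurableSet_eq (hJ : IsTierMark θ Φ J) (i : Fin K) :
    MeasurableSet {q : Ω × Space d | J q.1 q.2 = i} :=
  hJ.measurable (measurableSet_singleton i)

theorem IsTierMark.measurableSet_eq_section (hJ : IsTierMark θ Φ J) (i : Fin K) (ω : Ω) :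
    MeasurableSet {x | J ω x = i} :=
  measurable_prodMk_left (hJ.measurableSet_eq i)

theorem IsTierMark.counting_tier (hJ : IsTierMark θ Φ J) (i : Fin K) (ω : Ω)
    {B : Set (Space d)} (hB : MeasurableSet B) :
    counting (tier Φ J i) ω B = counting Φ ω (B ∩ {x | J ω x = i}) := by
  rw [counting_apply _ _ hB, counting_apply _ _ (hB.inter (hJ.measurableSet_eq_section i ω))]
  congr 1
  ext x
  simp only [tier, Set.mem_inter_iff, Set.mem_ofPred_eq]
  tauto

theorem IsTierMark.isPointProcess_tier (hJ : IsTierMark θ Φ J) (hΦ : IsPointProcess Φ)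
    (i : Fin K) : IsPointProcess (tier Φ J i) where
  locallyFinite ω r := (hΦ.locallyFinite ω r).subset fun _ hx => ⟨hx.1.1, hx.2⟩
  measurable_counting B hB := by
    simp_rw [hJ.counting_tier i _ hB]
    exact hΦ.measurable_counting_setOf ((measurable_snd hB).inter (hJ.measurableSet_eq i))

theorem IsTierMark.isCompatible_tier (hJ : IsTierMark θ Φ J) (hθ : IsMeasurableFlow θ)
    (hθΦ : IsCompatible θ Φ) (i : Fin K) : IsCompatible θ (tier Φ J i) := by
  intro x ω z
  have h := hθΦ x ω z
  constructor
  · rintro ⟨h1, h2⟩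
    refine ⟨h.1 h1, ?_⟩
    rw [← hJ.shift ω _ (h.1 h1), hθ.add, hJ.shift _ _ h1]
    exact h2
  · rintro ⟨h1, h2⟩
    refine ⟨h.2 h1, ?_⟩
    rw [← hJ.shift _ _ (h.2 h1), ← hθ.add, hJ.shift ω _ h1]
    exact h2

/-- At an atom the mark is read off at the origin after shifting, so thinning the process amounts to
intersecting the Palm event with `J ω 0 = i`. Both the intensity and the Palm measure of a tier
follow. -/
theorem IsTierMark.counting_tier_palm (hJ : IsTierMark θ Φ J) (hθ : IsMeasurableFlow θ)
    (i : Fin K) (ω : Ω) {A : Set Ω} (hA : MeasurableSet A) :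
    counting (tier Φ J i) ω ({x | θ x ω ∈ A} ∩ unitCube d) =
      counting Φ ω ({x | θ x ω ∈ A ∩ {ω | J ω 0 = i}} ∩ unitCube d) := by
  have h0 : MeasurableSet {ω | J ω 0 = i} := measurable_prodMk_right (hJ.measurableSet_eq i)
  have hm : ∀ {B : Set Ω}, MeasurableSet B → MeasurableSet ({x | θ x ω ∈ B} ∩ unitCube d) :=
    fun hB => (hθ.measurable_right ω hB).inter (measurableSet_unitCube d)
  rw [counting_apply _ _ (hm hA), counting_apply _ _ (hm (hA.inter h0))]
  congr 1
  ext x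
  simp only [tier, Set.mem_inter_iff, Set.mem_ofPred_eq]
  constructor
  · rintro ⟨⟨h1, h2⟩, h3, h4⟩
    exact ⟨⟨⟨h1, (hJ.shift ω x h3).trans h4⟩, h2⟩, h3⟩
  · rintro ⟨⟨⟨h1, h4⟩, h2⟩, h3⟩
    exact ⟨⟨h1, h2⟩, h3, (hJ.shift ω x h3).symm.trans h4⟩

theorem IsTierMark.intensity_tier {P : Measure Ω} (hJ : IsTierMark θ Φ J)
    (hθ : IsMeasurableFlow θ) (hΦ : IsPointProcess Φ) (hfin : intensity P Φ ≠ ∞) (i : Fin K) :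
    intensity P (tier Φ J i) = intensity P Φ * palm P θ Φ {ω | J ω 0 = i} := by
  have h0 : MeasurableSet {ω | J ω 0 = i} := measurable_prodMk_right (hJ.measurableSet_eq i)
  rw [intensity_mul_palm_apply hθ hΦ hfin h0, intensity]
  refine lintegral_congr fun ω => ?_
  have := hJ.counting_tier_palm hθ i ω MeasurableSet.univ
  simpa using this

theorem intensity_tier_le (P : Measure Ω) (i : Fin K) :
    intensity P (tier Φ J i) ≤ intensity P Φ := by
  refine lintegral_mono fun ω => ?_
  exact Measure.restrict_mono (fun x hx => hx.1) le_rfl _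

theorem IsTierMark.palm_tier {P : Measure Ω} (hJ : IsTierMark θ Φ J)
    (hθ : IsMeasurableFlow θ) (hΦ : IsPointProcess Φ) (hfin : intensity P Φ ≠ ∞) (i : Fin K) :
    palm P θ (tier Φ J i) = (palm P θ Φ)[|{ω | J ω 0 = i}] := by
  have h0 : MeasurableSet {ω | J ω 0 = i} := measurable_prodMk_right (hJ.measurableSet_eq i)
  ext A hA
  have hi := hJ.intensity_tier hθ hΦ hfin i
  rw [cond_apply h0, palm_apply P θ hθ _ (hJ.isPointProcess_tier hΦ i) A hA]
  have h1 : ∫⁻ ω, counting (tier Φ J i) ω (unitCube d ∩ {x | θ x ω ∈ A}) ∂P =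
      intensity P Φ * palm P θ Φ ({ω | J ω 0 = i} ∩ A) := by
    rw [Set.inter_comm _ A, intensity_mul_palm_apply hθ hΦ hfin (hA.inter h0)]
    refine lintegral_congr fun ω => ?_
    rw [Set.inter_comm]
    exact hJ.counting_tier_palm hθ i ω hA
  rw [h1, hi]
  -- If `λ = 0` both measures are zero. The case `p_i = 0` needs no split: both sides then carry the
  -- same factor `0⁻¹`.
  by_cases hl : intensity P Φ = 0
  · have hp : palm P θ Φ = 0 := by
      rw [palm, ← intensity_smul_palm hθ hΦ hfin, hl, zero_smul, smul_zero]
    simp [hp]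
  · rw [ENNReal.mul_inv (.inl hl) (.inl hfin), mul_mul_mul_comm, mul_comm _⁻¹ (intensity P Φ),
      mul_comm (intensity P Φ), ENNReal.inv_mul_cancel hl hfin, one_mul]

end Tier

/-! ### Association cells and mass transport -/

section ArgSup

variable {θ : Space d → Ω → Ω} {Φ : Ω → Set (Space d)} {S : Ω → Space d → Space d → ℝ≥0∞}

theorem IsMarkField.isArgSup_shift (hS : IsMarkField θ Φ S) (hθ : IsMeasurableFlow θ)
    (hθΦ : IsCompatible θ Φ) (z : Space d) (ω : Ω) (y x : Space d) :
    IsArgSup Φ S (θ z ω) y x ↔ IsArgSup Φ S ω (y + z) (x + z) := by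
  -- Marks are only tied to the field of an atom at the origin, so both sides are compared with the
  -- outcome `θ (x + z) ω`.
  have hS' : ∀ x ∈ Φ (θ z ω), S (θ z ω) x y = S ω (x + z) (y + z) := by
    intro x hx
    have h1 := hS.shift (θ z ω) x hx (y - x)
    have h2 := hS.shift ω (x + z) ((hθΦ z ω x).1 hx) (y - x)
    rw [← hθ.add] at h1
    rw [sub_add_cancel] at h1
    rw [← h1, h2]
    congr 1
    abel
  constructor
  · rintro ⟨hx, h⟩
    refine ⟨(hθΦ z ω x).1 hx, fun x' hx' hne => ?_⟩
    have hx'' : x' - z ∈ Φ (θ z ω) := (hθΦ z ω _).2 (by simpa using hx')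
    have := h _ hx'' fun e => hne (by rw [← e, sub_add_cancel])
    rwa [hS' _ hx, hS' _ hx'', sub_add_cancel] at this
  · rintro ⟨hx, h⟩
    have hx0 := (hθΦ z ω x).2 hx
    refine ⟨hx0, fun x' hx' hne => ?_⟩
    rw [hS' _ hx0, hS' _ hx']
    exact h _ ((hθΦ z ω x').1 hx') fun e => hne (add_right_cancel e)

/-- The relation `κ(y) = x` is jointly measurable in `ω`, `y` and `x`. -/
theorem IsMarkField.measurableSet_isArgSup (hS : IsMarkField θ Φ S) (hθ : IsMeasurableFlow θ)
    (hΦ : IsPointProcess Φ) (hθΦ : IsCompatible θ Φ) :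
    MeasurableSet {q : Ω × Space d × Space d | IsArgSup Φ S q.1 q.2.1 q.2.2} := by
  -- These are the rivals at least as strong as `x`. Being the arg sup means that no atom lies among
  -- them, a zero count, which avoids an uncountable quantifier.
  have hdom : MeasurableSet {r : (Ω × Space d × Space d) × Space d |
      r.2 ≠ r.1.2.2 ∧ S r.1.1 r.1.2.2 r.1.2.1 ≤ S r.1.1 r.2 r.1.2.1} := by
    have h1 : Measurable fun r : (Ω × Space d × Space d) × Space d =>
        S r.1.1 r.1.2.2 r.1.2.1 :=
      hS.measurable.comp (g := fun p : Ω × Space d × Space d => S p.1 p.2.1 p.2.2)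
        (f := fun r : (Ω × Space d × Space d) × Space d => (r.1.1, r.1.2.2, r.1.2.1))
        (by fun_prop)
    have h2 : Measurable fun r : (Ω × Space d × Space d) × Space d => S r.1.1 r.2 r.1.2.1 :=
      hS.measurable.comp (g := fun p : Ω × Space d × Space d => S p.1 p.2.1 p.2.2)
        (f := fun r : (Ω × Space d × Space d) × Space d => (r.1.1, r.2, r.1.2.1))
        (by fun_prop)
    have h3 : MeasurableSet {r : (Ω × Space d × Space d) × Space d | r.2 = r.1.2.2} :=
      measurableSet_eq_fun measurable_snd (by fun_prop)
    exact h3.compl.inter (measurableSet_le h1 h2)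
  have hcount := (hΦ.comp (measurable_fst : Measurable
    (Prod.fst : Ω × Space d × Space d → Ω))).measurable_counting_section hdom
  have heq : {q : Ω × Space d × Space d | IsArgSup Φ S q.1 q.2.1 q.2.2} =
      {q | q.2.2 ∈ Φ q.1} ∩ {q | counting (fun a : Ω × Space d × Space d => Φ a.1) q
        (Prod.mk q ⁻¹' {r : (Ω × Space d × Space d) × Space d |
          r.2 ≠ r.1.2.2 ∧ S r.1.1 r.1.2.2 r.1.2.1 ≤ S r.1.1 r.2 r.1.2.1}) = 0} := by
    ext q
    simp only [Set.mem_inter_iff, Set.mem_ofPred_eq]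
    rw [counting_eq_zero_iff _ _ (measurable_prodMk_left hdom), IsArgSup]
    refine and_congr_right fun _ => ⟨fun h x hx hxΦ => ?_, fun h x hx hne => ?_⟩
    · exact absurd (h x hxΦ hx.1) (not_lt.2 hx.2)
    · by_contra hlt
      exact h x ⟨hne, not_lt.1 hlt⟩ hx
  rw [heq]
  refine MeasurableSet.inter ?_ (hcount (measurableSet_singleton 0))
  exact (IsPointProcess.measurableSet_graph hθ hΦ hθΦ).preimage
    (f := fun q : Ω × Space d × Space d => (q.1, q.2.2)) (by fun_prop)

theorem IsMarkField.measurable_volume_cell (hS : IsMarkField θ Φ S) (hθ : IsMeasurableFlow θ)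
    (hΦ : IsPointProcess Φ) (hθΦ : IsCompatible θ Φ) (x : Space d) :
    Measurable fun ω => volume (cell Φ S ω x) := by
  have h : MeasurableSet {q : Ω × Space d | IsArgSup Φ S q.1 q.2 x} :=
    (hS.measurableSet_isArgSup hθ hΦ hθΦ).preimage
      (f := fun q : Ω × Space d => (q.1, q.2, x)) (by fun_prop)
  convert measurable_measure_prodMk_left (ν := volume) h using 2 with ω
  congr 1
  ext y
  exact mem_cell_iff

theorem IsMarkField.volume_cell_shift (hS : IsMarkField θ Φ S) (hθ : IsMeasurableFlow θ)
    (hθΦ : IsCompatible θ Φ) (ω : Ω) (x : Space d) :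
    volume (cell Φ S (θ x ω) 0) = volume (cell Φ S ω x) := by
  have : cell Φ S (θ x ω) 0 = (fun y => y + x) ⁻¹' cell Φ S ω x := by
    ext y
    rw [Set.mem_preimage, mem_cell_iff, mem_cell_iff, hS.isArgSup_shift hθ hθΦ, zero_add]
  rw [this, measure_preimage_add_right]

/-- Mass transport between the atoms of a compatible process `Ψ` in the unit cube, each sending
out the volume of its cell, and the origin. -/
theorem IsMarkField.lintegral_volume_cell {P : Measure Ω} [SFinite P]
    (hS : IsMarkField θ Φ S) (hθ : IsMeasurableFlow θ) (hP : IsStationary P θ)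
    (hΦ : IsPointProcess Φ) (hθΦ : IsCompatible θ Φ) {Ψ : Ω → Set (Space d)}
    (hΨ : IsPointProcess Ψ) (hθΨ : IsCompatible θ Ψ) :
    ∫⁻ ω, ∫⁻ x in unitCube d, volume (cell Φ S ω x) ∂(counting Ψ ω) ∂P =
      ∫⁻ ω, counting Ψ ω {x | IsArgSup Φ S ω 0 x} ∂P := by
  have hD := hS.measurableSet_isArgSup hθ hΦ hθΦ
  have hQ := measurableSet_unitCube d
  have hsend : MeasurableSet {r : (Ω × Space d) × Space d |
      IsArgSup Φ S r.1.1 r.1.2 r.2 ∧ r.2 ∈ unitCube d} :=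
    (hD.preimage (f := fun r : (Ω × Space d) × Space d => (r.1.1, r.1.2, r.2))
      (by fun_prop)).inter (measurable_snd hQ)
  have hrecv : MeasurableSet {r : (Ω × Space d) × Space d |
      r.2 + r.1.2 ∈ unitCube d ∧ IsArgSup Φ S r.1.1 0 r.2} :=
    (hQ.preimage (f := fun r : (Ω × Space d) × Space d => r.2 + r.1.2) (by fun_prop)).inter
      (hD.preimage (f := fun r : (Ω × Space d) × Space d => (r.1.1, 0, r.2)) (by fun_prop))
  have hΨ2 := hΨ.comp (measurable_fst : Measurable (Prod.fst : Ω × Space d → Ω))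
  have hsend_meas : Measurable fun q : Ω × Space d =>
      counting Ψ q.1 {x | IsArgSup Φ S q.1 q.2 x ∧ x ∈ unitCube d} :=
    hΨ2.measurable_counting_section hsend
  have hrecv_meas : Measurable fun q : Ω × Space d =>
      counting Ψ q.1 {x | x + q.2 ∈ unitCube d ∧ IsArgSup Φ S q.1 0 x} :=
    hΨ2.measurable_counting_section hrecv
  have hsend_eq : ∀ ω, ∫⁻ x in unitCube d, volume (cell Φ S ω x) ∂(counting Ψ ω) =
      ∫⁻ y, counting Ψ ω {x | IsArgSup Φ S ω y x ∧ x ∈ unitCube d} := by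
    intro ω
    -- Local finiteness makes the counting measure s-finite, as Tonelli requires.
    have := hΨ.isLocallyFiniteMeasure ω
    have ht : MeasurableSet {q : Space d × Space d | IsArgSup Φ S ω q.2 q.1} :=
      hD.preimage (f := fun q : Space d × Space d => (ω, q.2, q.1)) (by fun_prop)
    have h1 := Measure.prod_apply (μ := (counting Ψ ω).restrict (unitCube d))
      (ν := volume) ht
    rw [Measure.prod_apply_symm ht] at h1
    refine (lintegral_congr fun x => ?_).trans (h1.symm.trans (lintegral_congr fun y => ?_))
    · congr 1
      ext y
      exact mem_cell_iff
    · rw [Measure.restrict_apply (measurable_prodMk_right ht)]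
      rfl
  have hrecv_eq : ∀ ω, ∫⁻ y, counting Ψ ω {x | x + y ∈ unitCube d ∧ IsArgSup Φ S ω 0 x} =
      counting Ψ ω {x | IsArgSup Φ S ω 0 x} := by
    intro ω
    have := hΨ.isLocallyFiniteMeasure ω
    have ht : MeasurableSet {q : Space d × Space d | q.1 + q.2 ∈ unitCube d} :=
      hQ.preimage (f := fun q : Space d × Space d => q.1 + q.2) (by fun_prop)
    have h1 := Measure.prod_apply (ν := volume)
      (μ := (counting Ψ ω).restrict {x | IsArgSup Φ S ω 0 x}) ht
    rw [Measure.prod_apply_symm ht] at h1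
    -- The shifts bringing a given atom into the cube form a translate of the cube.
    have h2 : ∀ x : Space d, volume (Prod.mk x ⁻¹' {q : Space d × Space d |
        q.1 + q.2 ∈ unitCube d}) = 1 := by
      intro x
      rw [← volume_unitCube d]
      exact measure_preimage_add volume x (unitCube d)
    simp_rw [h2] at h1
    rw [lintegral_one, Measure.restrict_apply_univ] at h1
    rw [← h1]
    refine lintegral_congr fun y => ?_
    rw [Measure.restrict_apply (measurable_prodMk_right ht)]
    rfl
  have hshift : ∀ y ω, counting Ψ ω {x | IsArgSup Φ S ω y x ∧ x ∈ unitCube d} =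
      counting Ψ (θ y ω) {x | x + y ∈ unitCube d ∧ IsArgSup Φ S (θ y ω) 0 x} := by
    intro y ω
    have hm : MeasurableSet {x | x + y ∈ unitCube d ∧ IsArgSup Φ S (θ y ω) 0 x} :=
      hrecv.preimage (f := fun x : Space d => ((θ y ω, y), x)) (by fun_prop)
    rw [hθΨ.counting_shift y ω hm]
    congr 1
    ext x
    simp [hS.isArgSup_shift hθ hθΦ, and_comm]
  calc ∫⁻ ω, ∫⁻ x in unitCube d, volume (cell Φ S ω x) ∂(counting Ψ ω) ∂P
      = ∫⁻ ω, (∫⁻ y, counting Ψ ω {x | IsArgSup Φ S ω y x ∧ x ∈ unitCube d}) ∂P :=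
        lintegral_congr hsend_eq
    _ = ∫⁻ y : Space d, ∫⁻ ω, counting Ψ ω {x | IsArgSup Φ S ω y x ∧ x ∈ unitCube d} ∂P :=
        lintegral_lintegral_swap hsend_meas.aemeasurable
    _ = ∫⁻ y : Space d, ∫⁻ ω, counting Ψ ω {x | x + y ∈ unitCube d ∧ IsArgSup Φ S ω 0 x} ∂P := by
        refine lintegral_congr fun y => ?_
        simp_rw [hshift y]
        exact (hP y).lintegral_comp (hrecv_meas.comp measurable_prodMk_right)
    _ = ∫⁻ ω, (∫⁻ y, counting Ψ ω {x | x + y ∈ unitCube d ∧ IsArgSup Φ S ω 0 x}) ∂P :=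
        (lintegral_lintegral_swap hrecv_meas.aemeasurable).symm
    _ = ∫⁻ ω, counting Ψ ω {x | IsArgSup Φ S ω 0 x} ∂P := lintegral_congr hrecv_eq

end ArgSup

end HetNet

/-! ### The association probability -/

open HetNet in
theorem proposition2 {d K : ℕ} {Ω : Type*} [MeasurableSpace Ω]
    (P : Measure Ω) [IsProbabilityMeasure P]
    (θ : Space d → Ω → Ω) (hθ : IsMeasurableFlow θ) (hP : IsStationary P θ)
    (Φ : Ω → Set (Space d)) (hΦ : IsPointProcess Φ) (hθΦ : IsCompatible θ Φ)
    (hfin : intensity P Φ ≠ ∞)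
    (J : Ω → Space d → Fin K) (hJ : IsTierMark θ Φ J)
    (S : Ω → Space d → Space d → ℝ≥0∞) (hS : IsMarkField θ Φ S)
    (i : Fin K) :
    -- the origin lies in the cell of an atom of tier `i` exactly when `J(κ(0)) = i`
    {ω | ∃ x ∈ tier Φ J i ω, (0 : Space d) ∈ cell Φ S ω x} =
        {ω | ∃ x, assoc Φ S ω 0 = some x ∧ J ω x = i} ∧
      -- this is an event, and its probability is `λ p_i E^{o,i}[|C(T_0)|]`
      MeasurableSet {ω | ∃ x, assoc Φ S ω 0 = some x ∧ J ω x = i} ∧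
      P {ω | ∃ x, assoc Φ S ω 0 = some x ∧ J ω x = i} =
        intensity P Φ * palm P θ Φ {ω | J ω 0 = i} *
          ∫⁻ ω, volume (cell Φ S ω 0) ∂(palm P θ (tier Φ J i)) ∧
      -- the Palm probability of tier `i` is `P^o( · | J(T_0) = i)`, and `λ_i = λ p_i`
      palm P θ (tier Φ J i) = (palm P θ Φ)[|{ω | J ω 0 = i}] ∧
      intensity P (tier Φ J i) = intensity P Φ * palm P θ Φ {ω | J ω 0 = i} := by
  have hD := hS.measurableSet_isArgSup hθ hΦ hθΦ
  have hΨ := hJ.isPointProcess_tier hΦ i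
  have hD0 : MeasurableSet {q : Ω × Space d | IsArgSup Φ S q.1 0 q.2} :=
    hD.preimage (f := fun q : Ω × Space d => (q.1, 0, q.2)) (by fun_prop)
  have hDω : ∀ ω, MeasurableSet {x | IsArgSup Φ S ω 0 x} := fun ω => measurable_prodMk_left hD0
  have hcount : ∀ ω, counting (tier Φ J i) ω {x | IsArgSup Φ S ω 0 x} =
      {ω | ∃ x, assoc Φ S ω 0 = some x ∧ J ω x = i}.indicator 1 ω := by
    intro ω
    rw [counting_apply _ _ (hDω ω)]
    by_cases h : ω ∈ {ω | ∃ x, assoc Φ S ω 0 = some x ∧ J ω x = i}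
    · rw [Set.indicator_of_mem h]
      obtain ⟨x, hx, hxi⟩ := h
      rw [assoc_eq_some_iff] at hx
      have : {x | IsArgSup Φ S ω 0 x} ∩ tier Φ J i ω = {x} := by
        ext z
        refine ⟨fun hz => IsArgSup.unique hz.1 hx, ?_⟩
        rintro rfl
        exact ⟨hx, hx.1, hxi⟩
      rw [this, Measure.count_singleton, Pi.one_apply]
    · rw [Set.indicator_of_notMem h, Measure.count_eq_zero_iff,
        Set.eq_empty_iff_forall_notMem]
      rintro x ⟨hx, -, hxi⟩
      exact h ⟨x, (assoc_eq_some_iff Φ S ω 0 x).2 hx, hxi⟩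
  have hmeas : MeasurableSet {ω | ∃ x, assoc Φ S ω 0 = some x ∧ J ω x = i} := by
    have h := hΨ.measurable_counting_setOf (p := fun ω x => IsArgSup Φ S ω 0 x) hD0
    simp_rw [hcount] at h
    exact (measurable_indicator_const_iff (1 : ℝ≥0∞)).1 h
  have hi := hJ.intensity_tier hθ hΦ hfin i
  refine ⟨?_, hmeas, ?_, hJ.palm_tier hθ hΦ hfin i, hi⟩
  · ext ω
    refine exists_congr fun x => ⟨fun h => ⟨h.2, h.1.2⟩, fun h => ⟨⟨?_, h.2⟩, h.1⟩⟩
    exact ((assoc_eq_some_iff Φ S ω 0 x).1 h.1).1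
  -- Reading `λ p_i` as the intensity of the tier cancels the normalisation of its Palm measure.
  · rw [← hi, intensity_mul_lintegral_palm hθ hΨ
      (ne_top_of_le_ne_top hfin (intensity_tier_le P i))
      (hS.measurable_volume_cell hθ hΦ hθΦ 0)]
    simp_rw [hS.volume_cell_shift hθ hθΦ]
    rw [hS.lintegral_volume_cell hθ hP hΦ hθΦ hΨ (hJ.isCompatible_tier hθ hθΦ i),
      lintegral_congr hcount, lintegral_indicator_one hmeas]
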